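/- Let $T$ be a complete first-order theory in a language $L$, with $|T| = \max(|L|,\aleph_0)$ the number of $L$-formulas, and let $\mathfrak{C}$ be a monster model of $T$, i.e. a $\bar\kappa$-saturated model of $T$ for some cardinal $\bar\kappa > |T|^+$; cardinals below $\bar\kappa$ and sets of cardinality below $\bar\kappa$ are called small. A sequence of tuples from $\mathfrak{C}$ (of a fixed, possibly infinite, length), indexed by a linear order, is indiscernible over a set $C \subseteq \mathfrak{C}$ if, for every $k<\omega$, all its increasing $k$-tuples have the same type over $C$. A family of sequences is mutually indiscernible over $C$ if each sequence of the family is indiscernible over $C$ together with the elements of all the other sequences. Let $p(x)$ be a partial type over a small set $A \subseteq \mathfrak{C}$, in a finite tuple $x$ of variables. We say that $p$ has dp-rank $<\mu$, for a cardinal $\mu$, if for every realization $a$ of $p$ in $\mathfrak{C}$ and every family of $\mu$ infinite sequences which are mutually indiscernible over $A$, at least one of the sequences is indiscernible over $Aa$. The type $p$ is dependent if it has dp-rank $<\mu$ for some (small) cardinal $\mu$. **Proposition (shrinking of indiscernibles).** Suppose that $p(x)$ is a dependent type over $A$ and that $B$ is a set of realizations of $p$ in $\mathfrak{C}$. If $I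 = \langle a_i \mid i < |T|^+ + |B|^+ \rangle$ is a sequence indiscernible over $A$, where the $a_i$ are tuples of an arbitrary (possibly infinite) length, then there is $\alpha < |T|^+ + |B|^+$ such that the end segment $\langle a_i \mid \alpha < i < |T|^+ + |B|^+ \rangle$ is indiscernible over $AB$. -/

import Mathlib

open Cardinal Set FirstOrder

universe u v w x y

namespace DpRank

variable {L : FirstOrder.Language.{u, v}} {M : Type w} [L.Structure M]

/-- The cardinality `|T|` of a theory `T` in the language `L`: the number of `L`-formulas,
i.e. `max |L| ℵ₀`. -/
def theoryCard (_T : L.Theory) : Cardinal.{max u v} := #(L.Formula ℕ)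

/-- The tuple `a` realizes the set of formulas `p` over the parameter set `A`. -/
def Realizes {A : Set M} {n : ℕ} (p : Set (L[[A]].Formula (Fin n))) (a : Fin n → M) : Prop :=
  ∀ φ ∈ p, φ.Realize a

variable (L M) in
/-- `M` is `κ`-saturated: every set of formulas in one variable, over a parameter set of
cardinality `< κ`, which is finitely satisfiable in `M` is realized in `M`. -/
def IsSaturated (κ : Cardinal.{w}) : Prop :=
  ∀ A : Set M, #A < κ → ∀ p : Set (L[[A]].Formula (Fin 1)),
    (∀ s : Finset (L[[A]].Formula (Fin 1)), (s : Set (L[[A]].Formula (Fin 1))) ⊆ p →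
      ∃ a : Fin 1 → M, Realizes (s : Set (L[[A]].Formula (Fin 1))) a) →
    ∃ a : Fin 1 → M, Realizes p a

/-- `M` is a monster model of `T` of degree `κ`: a model of `T` which is `κ`-saturated, where `κ`
is large compared with `|T|`. The cardinals `< κ` are the *small* ones. -/
structure IsMonster (T : L.Theory) (M : Type w) [L.Structure M] (κ : Cardinal.{w}) : Prop where
  model : M ⊨ T
  saturated : IsSaturated L M κ
  large : Cardinal.lift.{w} (Order.succ (theoryCard T)) < Cardinal.lift.{max u v} κ

variable (L) in
/-- The sequence `a = ⟨a i | i ∈ ι⟩` of `γ`-tuples, indexed by a linear order, is indiscernible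
over the set `C`: all increasing `k`-tuples of its members satisfy the same formulas over `C`. -/
def Indiscernible (C : Set M) {ι : Type x} [LinearOrder ι] {γ : Type y} (a : ι → γ → M) : Prop :=
  ∀ (k : ℕ) (φ : L[[C]].Formula (Fin k × γ)) (f g : Fin k ↪o ι),
    φ.Realize (fun z => a (f z.1) z.2) ↔ φ.Realize (fun z => a (g z.1) z.2)

/-- The set of all coordinates of the members of a sequence of tuples. -/
def entries {ι : Type x} {γ : Type y} (a : ι → γ → M) : Set M :=
  {m | ∃ i c, a i c = m}

variable (L) in
/-- The sequences `I k` (`k ∈ K`) are mutually indiscernible over `A`: each of them is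
indiscernible over `A` together with all the other sequences. The index orders and the lengths
of the tuples may vary with `k`. -/
def MutuallyIndiscernible (A : Set M) {K : Type w} {ι γ : K → Type w} [∀ k, LinearOrder (ι k)]
    (I : ∀ k, ι k → γ k → M) : Prop :=
  ∀ k, Indiscernible L (A ∪ ⋃ j ∈ {j | j ≠ k}, entries (I j)) (I k)

/-- The type `p` over `A` has dp-rank `< μ`: for every realization `a` of `p` and every `μ`
sequences which are mutually indiscernible over `A`, at least one of them is indiscernible
over `Aa`. (As usual, the indiscernible sequences are infinite.) -/
def DpRankLT {A : Set M} {n : ℕ} (p : Set (L[[A]].Formula (Fin n))) (μ : Cardinal.{w}) : Prop :=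
  ∀ a : Fin n → M, Realizes p a →
    ∀ (K : Type w) (ι γ : K → Type w) [∀ k, LinearOrder (ι k)] [∀ k, Infinite (ι k)]
      (I : ∀ k, ι k → γ k → M),
      #K = μ → MutuallyIndiscernible L A I →
        ∃ k, Indiscernible L (A ∪ range a) (I k)

/-- The type `p` over `A` is dependent: it has dp-rank `< μ` for some cardinal `μ`. Here `M` is a
monster model of degree `κ`, and, as always inside a monster model, `μ` ranges over the small
cardinals. -/
def IsDependent (κ : Cardinal.{w}) {A : Set M} {n : ℕ} (p : Set (L[[A]].Formula (Fin n))) :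
    Prop :=
  ∃ μ < κ, DpRankLT p μ

end DpRank

/-!
The classical route is taken: dependence of `p` is used only through the absence of the independence
property (`DpRank.HasIP`), and the end segment is found by an alternation argument.

*Dependent types have no independence property* (`DpRank.IsDependent.not_hasIP`). Suppose that
`φ(x; y)` has the independence property on `p`. Ramsey's theorem and saturation give a realization
`b` of `p` and an `A`-indiscernible sequence of order type `μ × ω`, ordered lexicographically, such
that `φ(b; y)` holds exactly at the first member of each row
(`DpRank.HasIP.exists_indiscernible`). The rows are mutually indiscernible over `A`
(`DpRank.mutuallyIndiscernible_rows`) and none of them is indiscernible over `Ab`, so `p` does not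
have dp-rank `< μ`.

*One realization* (`DpRank.exists_tail_indiscernible`). Let `b` realize `p` and let the sequence be
indiscernible over some `C ⊇ A`. If no end segment is indiscernible over `Cb`, then beyond each index
there is a failure, witnessed by a formula `φ(x; y)` without parameters, into which elements of `C`
and coordinates of the sequence are substituted for `y`. There are only `|T|` such formulas, so one
of them occurs cofinally often, although the parameters and coordinates may vary. On successive
disjoint blocks of the sequence, `b` then realizes every pattern of truth values of `φ`, up to
replacing increasing tuples by others. Indiscernibility over `C` moves these patterns to one fixed
sequence of tuples, and `φ` has the independence property on `p` (`DpRank.hasIP_of_cofinal`).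

*All realizations.* Since the previous step allows any base `C ⊇ A`, finitely many realizations are
added one at a time. For the whole of `B`, the length of the sequence is a regular cardinal greater
than the number of finite subsets of `B`, and a formula involves only finitely many parameters, so
the supremum of the bounds for the finite subsets works (`DpRank.exists_tail_indiscernible_set`).
-/

namespace DpRank

/-! ### Definable sets in possibly infinitely many variables -/

section Definable

variable {L : FirstOrder.Language.{u, v}} {M : Type w} [L.Structure M]

/-- Membership in a definable set depends on finitely many coordinates only. -/
theorem definable_exists_support {V : Type*} {A : Set M} {S : Set (V → M)} (hS : A.Definable L S) :
    ∃ F : Finset V, ∀ v v' : V → M, (∀ i ∈ F, v i = v' i) → (v ∈ S ↔ v' ∈ S) := by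
  classical
  obtain ⟨φ, rfl⟩ := hS
  refine ⟨φ.freeVarFinset, fun v v' h => ?_⟩
  have key (w : V → M) := Language.BoundedFormula.realize_restrictFreeVar' (φ := φ)
    (s := ↑φ.freeVarFinset) Subset.rfl (v := w) (xs := default)
  have hvv : v ∘ Subtype.val = v' ∘ Subtype.val :=
    funext fun i : ↥(φ.freeVarFinset : Set V) => h i.1 i.2
  exact (key v).symm.trans (hvv ▸ key v')

/-- Definable sets are stable under substituting parameters and variables for variables. -/
theorem definable_subst {V W : Type*} {A : Set M} {S : Set (V → M)} (hS : A.Definable L S)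
    (ρ : V → A ⊕ W) :
    A.Definable L {w : W → M | (fun i => Sum.elim (↑) w (ρ i)) ∈ S} := by
  rw [definable_iff_exists_formula_sum] at hS ⊢
  obtain ⟨φ, rfl⟩ := hS
  refine ⟨φ.relabel (Sum.elim Sum.inl ρ), ?_⟩
  ext w
  simp only [mem_ofPred_eq, Language.Formula.realize_relabel]
  apply iff_of_eq
  congr 1
  funext i
  rcases i with i | i <;> simp

/-- The projection of a definable set, in possibly infinitely many variables, along finitely many
coordinates is definable. -/
theorem definable_proj {I J : Type*} [Finite I] [Nonempty I] {A : Set M} {S : Set (J → M)}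
    (hS : A.Definable L S) (g : I → J) :
    A.Definable L {u : I → M | ∃ v ∈ S, ∀ i, v (g i) = u i} := by
  classical
  obtain ⟨F, hF⟩ := definable_exists_support hS
  have := Fintype.ofFinite I
  let F' : Finset J := F ∪ Finset.univ.image g
  have hg (i : I) : g i ∈ F' := by simp [F']
  let ρ : J → F' := fun j => if h : j ∈ F' then ⟨j, h⟩ else ⟨_, hg (Classical.arbitrary I)⟩
  have hρ (j : F') : ρ j = j := by simp [ρ]
  convert (hS.preimage_comp ρ).image_comp (fun i : I => (⟨g i, hg i⟩ : F')) using 1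
  ext u
  constructor
  · rintro ⟨v, hv, hu⟩
    refine ⟨fun j => v j, ?_, funext hu⟩
    refine (hF v _ fun j hj => ?_).1 hv
    have hj' : j ∈ F' := by simp [F', hj]
    simpa using congrArg v (congrArg Subtype.val (hρ ⟨j, hj'⟩)).symm
  · rintro ⟨w, hw, rfl⟩
    exact ⟨w ∘ ρ, hw, fun i => congrArg w (hρ ⟨g i, hg i⟩)⟩

theorem definable_of_formula {V : Type*} (A : Set M) (φ : L.Formula V) :
    A.Definable L {v : V → M | φ.Realize v} :=
  (empty_definable_iff.2 ⟨φ, rfl⟩).mono (empty_subset A)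

theorem definable_iff {V : Type*} {A : Set M} {P Q : (V → M) → Prop}
    (hP : A.Definable L {v | P v}) (hQ : A.Definable L {v | Q v}) :
    A.Definable L {v | P v ↔ Q v} := by
  convert (hP.inter hQ).union (hP.compl.inter hQ.compl) using 1
  ext v
  simp only [mem_ofPred_eq, mem_union, mem_inter_iff, mem_compl_iff]
  tauto

theorem definable_iff_const {V : Type*} {A : Set M} {P : (V → M) → Prop}
    (hP : A.Definable L {v | P v}) (q : Prop) : A.Definable L {v | P v ↔ q} := by
  by_cases hq : q <;> simp only [hq, iff_true, iff_false]
  · exact hP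
  · exact hP.compl

end Definable

/-! ### Indiscernible sequences -/

section Indiscernible

variable {L : FirstOrder.Language.{u, v}} {M : Type w} [L.Structure M]
variable {ι : Type x} [LinearOrder ι] {γ : Type y} {a : ι → γ → M} {C : Set M}

theorem indiscernible_iff_definable :
    Indiscernible L C a ↔ ∀ (k : ℕ) (S : Set (Fin k × γ → M)), C.Definable L S →
      ∀ f g : Fin k ↪o ι, (fun z => a (f z.1) z.2) ∈ S ↔ (fun z => a (g z.1) z.2) ∈ S := by
  constructor
  · rintro h k S ⟨φ, rfl⟩ f g
    exact h k φ f g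
  · intro h k φ f g
    exact h k {v | φ.Realize v} ⟨φ, rfl⟩ f g

theorem Indiscernible.mono {D : Set M} (h : Indiscernible L C a) (hD : D ⊆ C) :
    Indiscernible L D a := by
  rw [indiscernible_iff_definable] at h ⊢
  exact fun k S hS => h k S (hS.mono hD)

/-- Indiscernibility is of finite character in the parameters. -/
theorem indiscernible_of_finite
    (h : ∀ D : Finset M, (D : Set M) ⊆ C → Indiscernible L (D : Set M) a) :
    Indiscernible L C a := by
  rw [indiscernible_iff_definable]
  intro k S hS
  obtain ⟨D, hD, hS⟩ := definable_iff_finitely_definable.1 hS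
  exact indiscernible_iff_definable.1 (h D hD) k S hS

theorem Indiscernible.comp {ι' : Type*} [LinearOrder ι'] (h : Indiscernible L C a)
    (e : ι' ↪o ι) : Indiscernible L C (fun i => a (e i)) :=
  fun k φ f g => h k φ (f.trans e) (g.trans e)

/-- The working form of indiscernibility: two families of indices of the same order type, finite or
not, give tuples satisfying the same formulas over the parameters. -/
theorem Indiscernible.mem_iff {Z V : Type*} (h : Indiscernible L C a) {r r' : Z → ι}
    (hr : ∀ z z', r z < r z' ↔ r' z < r' z') {S : Set (V → M)} (hS : C.Definable L S)
    (e : V → C ⊕ Z × γ) :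
    (fun i => Sum.elim (↑) (fun z : Z × γ => a (r z.1) z.2) (e i)) ∈ S ↔
      (fun i => Sum.elim (↑) (fun z : Z × γ => a (r' z.1) z.2) (e i)) ∈ S := by
  classical
  have hS' := definable_subst hS e
  obtain ⟨F, hF⟩ := definable_exists_support hS'
  -- Only finitely many indices matter; `s` lists their images under `r` in increasing order.
  let E : Finset Z := F.image Prod.fst
  let s : Finset ι := E.image r
  let f : Fin s.card ↪o ι := s.orderEmbOfFin rfl
  have hex (j : Fin s.card) : ∃ z ∈ E, r z = f j := by
    exact Finset.mem_image.1 (s.orderEmbOfFin_mem rfl j)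
  choose t htE ht using hex
  let g : Fin s.card ↪o ι := OrderEmbedding.ofStrictMono (fun j => r' (t j)) fun j j' hj => by
    rw [← hr, ht, ht]
    exact f.strictMono hj
  have hrange (z : Z) (hz : z ∈ E) : ∃ j, f j = r z := by
    have : r z ∈ (s : Set ι) := Finset.mem_coe.2 (Finset.mem_image_of_mem r hz)
    rwa [← s.range_orderEmbOfFin rfl] at this
  rcases isEmpty_or_nonempty (Fin s.card) with hE | hE
  · have hF0 : F = ∅ := by
      by_contra hne
      obtain ⟨z, hz⟩ := Finset.nonempty_iff_ne_empty.2 hne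
      obtain ⟨j, -⟩ := hrange z.1 (Finset.mem_image_of_mem _ hz)
      exact hE.elim j
    exact hF _ _ (by simp [hF0])
  have : ∀ z, ∃ j, z ∈ E → f j = r z := fun z => by
    by_cases hz : z ∈ E
    · obtain ⟨j, hj⟩ := hrange z hz
      exact ⟨j, fun _ => hj⟩
    · exact ⟨Classical.arbitrary _, fun h => absurd h hz⟩
  choose d hd using this
  have hd' (z : Z) (hz : z ∈ E) : g (d z) = r' z := by
    have h1 : r (t (d z)) = r z := (ht _).trans (hd z hz)
    exact le_antisymm (not_lt.1 fun hlt => ((hr _ _).2 hlt).ne h1.symm)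
      (not_lt.1 fun hlt => ((hr _ _).2 hlt).ne h1)
  have key := indiscernible_iff_definable.1 h _ _
    (hS'.preimage_comp (fun z : Z × γ => (d z.1, z.2))) f g
  refine Iff.trans (hF _ _ ?_) (key.trans (hF _ _ ?_))
  · intro z hz
    simp [hd z.1 (Finset.mem_image_of_mem _ hz)]
  · intro z hz
    simp [hd' z.1 (Finset.mem_image_of_mem _ hz)]

end Indiscernible

/-! ### Realizing types in many variables -/

section Saturation

variable {L : FirstOrder.Language.{u, v}} {M : Type w} [L.Structure M]

/-- A saturated structure realizes types in fewer than `κ` variables. -/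
theorem IsSaturated.exists_mem_of_finite_inter {κ : Cardinal.{w}} (hM : IsSaturated L M κ)
    (hκ : ℵ₀ ≤ κ) {A : Set M} (hA : #A < κ) {J : Type w} (hJ : #J < κ) (Φ : Set (Set (J → M)))
    (hΦ : ∀ S ∈ Φ, A.Definable L S)
    (hfin : ∀ T : Finset (Set (J → M)), (T : Set (Set (J → M))) ⊆ Φ → ∃ v, ∀ S ∈ T, v ∈ S) :
    ∃ v, ∀ S ∈ Φ, v ∈ S := by
  classical
  -- `G` is the graph of a partial assignment of values to the variables, which is maximal among
  -- those that are consistent with every finite part of `Φ`.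
  let Q : Set (J × M) → Prop := fun G => ∀ T : Finset (Set (J → M)),
    (T : Set (Set (J → M))) ⊆ Φ → ∀ H : Finset (J × M), (H : Set (J × M)) ⊆ G →
      ∃ v : J → M, (∀ S ∈ T, v ∈ S) ∧ ∀ q ∈ H, v q.1 = q.2
  obtain ⟨G, -, hG⟩ := zorn_subset_nonempty {G | Q G} (by
    intro c hc hchain hne
    refine ⟨⋃₀ c, fun T hT H hH => ?_, fun s hs => subset_sUnion_of_mem hs⟩
    obtain ⟨G, hGc, hHG⟩ := DirectedOn.exists_mem_subset_of_finset_subset_biUnion (f := id)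
      hne hchain.directedOn (s := H) (by simpa [sUnion_eq_biUnion] using hH)
    exact hc hGc T hT H hHG) ∅ (by
      intro T hT H hH
      obtain ⟨v, hv⟩ := hfin T hT
      refine ⟨v, hv, fun q hq => absurd (hH hq) (notMem_empty q)⟩)
  have hQ : Q G := hG.prop
  have hfun : ∀ q ∈ G, ∀ q' ∈ G, q.1 = q'.1 → q = q' := by
    intro q hq q' hq' h
    obtain ⟨v, -, hv⟩ := hQ ∅ (by simp) {q, q'} (by simp [insert_subset_iff, hq, hq'])
    exact Prod.ext h ((hv q (by simp)).symm.trans ((congrArg v h).trans (hv q' (by simp))))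
  have htotal : ∀ j, ∃ m, (j, m) ∈ G := by
    intro j
    let A' : Set M := A ∪ Prod.snd '' G
    have hA' : #A' < κ := by
      refine (mk_union_le _ _).trans_lt (add_lt_of_lt hκ hA (mk_image_le.trans_lt ?_))
      refine (mk_le_of_injective (f := fun q : G => q.1.1) ?_).trans_lt hJ
      intro q q' h
      exact Subtype.ext (hfun _ q.2 _ q'.2 h)
    -- `p` is what `Φ` and `G` say about the variable `j`: a type over `A` and the values in `G`.
    let p : Set (L[[A']].Formula (Fin 1)) := {ψ | ∃ T : Finset (Set (J → M)),
      (T : Set (Set (J → M))) ⊆ Φ ∧ ∃ H : Finset (J × M), (H : Set (J × M)) ⊆ G ∧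
      ∀ v : J → M, (∀ S ∈ T, v ∈ S) → (∀ q ∈ H, v q.1 = q.2) → ψ.Realize fun _ => v j}
    obtain ⟨m, hm⟩ := hM A' hA' p (by
      intro s hs
      have hs' : ∀ ψ : s, ψ.1 ∈ p := fun ψ => hs ψ.2
      choose T hT H hH hTH using hs'
      obtain ⟨v, hvT, hvH⟩ := hQ (Finset.univ.biUnion T) (by simpa using hT)
        (Finset.univ.biUnion H) (by simpa using hH)
      refine ⟨fun _ => v j, fun ψ hψ => hTH ⟨ψ, hψ⟩ v (fun S hS => hvT S ?_) fun q hq => hvH q ?_⟩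
      · exact Finset.mem_biUnion.2 ⟨_, Finset.mem_univ _, hS⟩
      · exact Finset.mem_biUnion.2 ⟨_, Finset.mem_univ _, hq⟩)
    refine ⟨m 0, ?_⟩
    suffices h : Q (insert (j, m 0) G) from
      hG.le_of_ge h (subset_insert _ _) (mem_insert _ _)
    intro T hT H hH
    -- `∃ v` satisfying the conditions in `T` and `H'` with `v j = y` is a formula in `y` that
    -- belongs to `p`, so it holds at `m 0`.
    let H' := H.erase (j, m 0)
    have hH' : (H' : Set (J × M)) ⊆ G := by
      intro q hq
      obtain ⟨hne, hq⟩ := Finset.mem_erase.1 hq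
      exact (hH hq).resolve_left hne
    have hdef : A.Definable L {v : J → M | ∀ S ∈ T, v ∈ S} := by
      have := definable_biInter_finset (L := L) (A := A) (f := fun S : Φ => S.1)
        (fun S => hΦ S S.2) (T.subtype (· ∈ Φ))
      convert this using 1
      ext v
      simp only [mem_ofPred_eq, mem_iInter, Finset.mem_subtype, Subtype.forall]
      exact ⟨fun h S _ hS => h S hS, fun h S hS => h S (hT hS) hS⟩
    have hproj := definable_subst
      ((definable_proj hdef (Sum.elim (fun _ => j) (fun q => q.1.1) : Fin 1 ⊕ H' → J)).mono
        (subset_union_left : A ⊆ A'))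
      (Sum.elim Sum.inr (fun q => Sum.inl ⟨q.1.2, Or.inr ⟨q.1, hH' q.2, rfl⟩⟩) :
        Fin 1 ⊕ H' → A' ⊕ Fin 1)
    obtain ⟨ψ, hψ⟩ := hproj
    have hmem : ψ ∈ p := by
      refine ⟨T, hT, H', hH', fun v hvT hvH => ?_⟩
      change (fun _ => v j) ∈ {w | ψ.Realize w}
      rw [← hψ]
      refine ⟨v, hvT, ?_⟩
      rintro (i | q)
      · rfl
      · exact hvH q.1 q.2
    have := hm ψ hmem
    change m ∈ {w | ψ.Realize w} at this
    rw [← hψ] at this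
    obtain ⟨v, hvT, hv⟩ := this
    refine ⟨v, hvT, fun q hq => ?_⟩
    by_cases hqe : q = (j, m 0)
    · subst hqe
      exact hv (Sum.inl 0)
    · exact hv (Sum.inr ⟨q, Finset.mem_erase.2 ⟨hqe, hq⟩⟩)
  choose v hv using htotal
  refine ⟨v, fun S hS => ?_⟩
  obtain ⟨F, hF⟩ := definable_exists_support (hΦ S hS)
  obtain ⟨v', hv'S, hv'⟩ := hQ {S} (by simpa using hS) (F.image fun j => (j, v j)) (by
    intro q hq
    obtain ⟨j, -, rfl⟩ := Finset.mem_image.1 hq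
    exact hv j)
  exact (hF v' v fun j hj => hv' (j, v j) (Finset.mem_image_of_mem _ hj)).1 (hv'S S (by simp))

end Saturation

/-! ### Finite homogeneous sets -/

section Ramsey

open Filter

/-- The truth value of a property of `k`-element sets of natural numbers along the `k`-th power of
the ultrafilter `U`. -/
def ultraLimit (U : Ultrafilter ℕ) : ℕ → (Finset ℕ → Prop) → Prop
  | 0, P => P ∅
  | k + 1, P => ∀ᶠ i in U, ultraLimit U k fun S => P (insert i S)

/-- Ramsey's theorem, for finitely many properties `P q` of `k q`-element sets: there are
homogeneous sets of every finite size. -/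
theorem exists_homogeneous {Q : Type*} [Finite Q] (k : Q → ℕ) (P : Q → Finset ℕ → Prop) (N : ℕ) :
    ∃ H : Finset ℕ, H.card = N ∧ ∀ q, ∀ S ⊆ H, ∀ S' ⊆ H, S.card = k q → S'.card = k q →
      (P q S ↔ P q S') := by
  classical
  let U : Ultrafilter ℕ := hyperfilter ℕ
  -- `H` is built one point at a time, so that each subset of `H` can still be completed by
  -- `U`-generic points to a set of the generic colour.
  suffices h : ∃ H : Finset ℕ, H.card = N ∧ ∀ q, ∀ S ⊆ H, ∀ d, S.card + d = k q →
      (ultraLimit U d (fun S' => P q (S ∪ S')) ↔ ultraLimit U (k q) (P q)) by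
    obtain ⟨H, hN, hH⟩ := h
    refine ⟨H, hN, fun q S hS S' hS' hk hk' => ?_⟩
    have h1 := hH q S hS 0 hk
    have h2 := hH q S' hS' 0 hk'
    simp only [ultraLimit, Finset.union_empty] at h1 h2
    exact h1.trans h2.symm
  induction N with
  | zero =>
    refine ⟨∅, rfl, fun q S hS d hd => ?_⟩
    obtain rfl := Finset.subset_empty.1 hS
    obtain rfl : d = k q := by simpa using hd
    simp
  | succ N ih =>
    obtain ⟨H, hN, hH⟩ := ih
    have hev : ∀ᶠ i in U, i ∉ H ∧ ∀ q, ∀ S ∈ H.powerset, ∀ d ∈ Finset.range (k q),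
        S.card + (d + 1) = k q →
        (ultraLimit U d (fun S' => P q (insert i S ∪ S')) ↔ ultraLimit U (k q) (P q)) := by
      refine Filter.Eventually.and ?_ ?_
      · exact H.finite_toSet.compl_mem_hyperfilter
      · refine Filter.eventually_all.2 fun q => (Filter.eventually_all_finset _).2 fun S hS =>
          (Filter.eventually_all_finset _).2 fun d _ => ?_
        by_cases hd : S.card + (d + 1) = k q
        · have h1 := hH q S (Finset.mem_powerset.1 hS) (d + 1) hd
          have heq : ∀ i, (fun S' => P q (S ∪ insert i S')) = fun S' => P q (insert i S ∪ S') := by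
            intro i
            funext S'
            rw [Finset.union_insert, Finset.insert_union]
          simp only [ultraLimit, heq] at h1
          by_cases hl : ultraLimit U (k q) (P q)
          · filter_upwards [h1.2 hl] with i hi _
            exact iff_of_true hi hl
          · have h2 := Ultrafilter.eventually_not.2 (mt h1.1 hl)
            filter_upwards [h2] with i hi _
            exact iff_of_false hi hl
        · exact Filter.Eventually.of_forall fun i h => absurd h hd
    obtain ⟨i, hiH, hi⟩ := hev.exists
    refine ⟨insert i H, by rw [Finset.card_insert_of_notMem hiH, hN], fun q S hS d hd => ?_⟩
    by_cases hiS : i ∈ S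
    · have hS' : S.erase i ⊆ H := Finset.subset_insert_iff.1 hS
      have hc := Finset.card_erase_add_one hiS
      have := hi q (S.erase i) (Finset.mem_powerset.2 hS') d
        (Finset.mem_range.2 (by omega)) (by omega)
      rwa [Finset.insert_erase hiS] at this
    · exact hH q S ((Finset.subset_insert_iff_of_notMem hiS).1 hS) d hd

end Ramsey

/-! ### The independence property and dp-rank -/

section IndependenceProperty

variable {L : FirstOrder.Language.{u, v}} {M : Type w} [L.Structure M]

/-- The formula `φ(x; y)` has the independence property on the partial type `p(x)`: there is an
infinite sequence of parameters `c i` such that every pattern of truth values of the `φ(x; c i)` is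
finitely consistent with `p`. The tuple `y` is given the length `ℕ` for uniformity; only finitely
many of its coordinates occur in `φ`. -/
def HasIP {A : Set M} {n : ℕ} (p : Set (L[[A]].Formula (Fin n))) (φ : L.Formula (Fin n ⊕ ℕ)) :
    Prop :=
  ∃ c : ℕ → ℕ → M, ∀ p₀ : Finset (L[[A]].Formula (Fin n)),
    (p₀ : Set (L[[A]].Formula (Fin n))) ⊆ p → ∀ (N : ℕ) (s : Set ℕ), ∃ x : Fin n → M,
      Realizes (p₀ : Set (L[[A]].Formula (Fin n))) x ∧
        ∀ i < N, (φ.Realize (Sum.elim x (c i)) ↔ i ∈ s)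

/-- In a saturated structure, the independence property of `φ` on `p` yields an indiscernible
sequence of any small order type on which a realization of `p` makes `φ` follow a prescribed
pattern. -/
theorem HasIP.exists_indiscernible {κ : Cardinal.{w}} (hM : IsSaturated L M κ) (hκ : ℵ₀ < κ)
    {A : Set M} (hA : #A < κ) {n : ℕ} {p : Set (L[[A]].Formula (Fin n))}
    {φ : L.Formula (Fin n ⊕ ℕ)} (hp : HasIP p φ) {O : Type w} [LinearOrder O] (hO : #O < κ)
    (η : O → Prop) :
    ∃ (b : Fin n → M) (d : O → ℕ → M), Realizes p b ∧ Indiscernible L A d ∧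
      ∀ o, (φ.Realize (Sum.elim b (d o)) ↔ η o) := by
  classical
  obtain ⟨c, hc⟩ := hp
  have hJ : #(Fin n ⊕ O × ℕ) < κ := by
    simp only [mk_sum, mk_prod, mk_fin, lift_natCast, mk_nat, lift_aleph0, lift_uzero]
    exact add_lt_of_lt hκ.le (natCast_lt_aleph0.trans hκ) (mul_lt_of_lt hκ.le hO hκ)
  -- The variables are those of `b` and of the sequence `d`. The conditions `W` are indexed by the
  -- formulas of `p`, by the instances of indiscernibility, and by the places of the pattern.
  let X := Σ k : ℕ, L[[A]].Formula (Fin k × ℕ) × (Fin k ↪o O) × (Fin k ↪o O)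
  let W : p ⊕ X ⊕ O → Set (Fin n ⊕ O × ℕ → M) := Sum.elim
    (fun ψ => {v | ψ.1.Realize fun i => v (Sum.inl i)}) (Sum.elim
    (fun q => {v | q.2.1.Realize (fun z => v (Sum.inr (q.2.2.1 z.1, z.2))) ↔
      q.2.1.Realize (fun z => v (Sum.inr (q.2.2.2 z.1, z.2)))})
    (fun o => {v | φ.Realize (Sum.elim (fun i => v (Sum.inl i)) fun t => v (Sum.inr (o, t))) ↔
      η o}))
  have hWdef : ∀ S ∈ range W, A.Definable L S := by
    rintro _ ⟨ψ | q | o, rfl⟩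
    · have h : A.Definable L {v : Fin n → M | ψ.1.Realize v} := ⟨ψ.1, rfl⟩
      exact h.preimage_comp Sum.inl
    · have h : A.Definable L {v : Fin q.1 × ℕ → M | q.2.1.Realize v} := ⟨q.2.1, rfl⟩
      exact definable_iff
        (h.preimage_comp fun z : Fin q.1 × ℕ => (Sum.inr (q.2.2.1 z.1, z.2) : Fin n ⊕ O × ℕ))
        (h.preimage_comp fun z : Fin q.1 × ℕ => (Sum.inr (q.2.2.2 z.1, z.2) : Fin n ⊕ O × ℕ))
    · refine definable_iff_const ?_ _
      convert (definable_of_formula A φ).preimage_comp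
        (Sum.elim Sum.inl (fun t => Sum.inr (o, t)) : Fin n ⊕ ℕ → Fin n ⊕ O × ℕ) using 1
      ext v
      simp only [mem_ofPred_eq, mem_preimage]
      apply iff_of_eq
      congr 1
      funext i
      rcases i with i | i <;> rfl
  obtain ⟨v, hv⟩ := hM.exists_mem_of_finite_inter hκ.le hA hJ (range W) hWdef (by
    intro T hT
    rw [← image_univ, Finset.subset_set_image_iff] at hT
    obtain ⟨T, -, rfl⟩ := hT
    let p₀ : Finset (L[[A]].Formula (Fin n)) := T.toLeft.image Subtype.val
    let X₀ : Finset X := T.toRight.toLeft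
    -- `P` is the finite set of indices that the conditions in `T` mention.
    let P : Finset O := T.toRight.toRight ∪
      X₀.biUnion fun q => Finset.univ.image q.2.2.1 ∪ Finset.univ.image q.2.2.2
    obtain ⟨H, hHc, hH⟩ := exists_homogeneous (Q := X₀) (fun q => q.1.1)
      (fun q S => ∀ h : S.card = q.1.1,
        q.1.2.1.Realize fun z => c (S.orderEmbOfFin h z.1) z.2) P.card
    -- The members of `P` are interpreted, in increasing order, by those of the homogeneous set.
    let h : O → ℕ := fun o => if ho : o ∈ P then
      H.orderEmbOfFin hHc ((P.orderIsoOfFin rfl).symm ⟨o, ho⟩) else 0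
    have hmono : ∀ o ∈ P, ∀ o' ∈ P, o < o' → h o < h o' := by
      intro o ho o' ho' hlt
      simpa [h, ho, ho'] using hlt
    have hmem : ∀ o ∈ P, h o ∈ H := by
      intro o ho
      simp only [h, ho, dite_true]
      exact Finset.orderEmbOfFin_mem ..
    have hinj : ∀ o ∈ P, ∀ o' ∈ P, h o = h o' → o = o' := by
      intro o ho o' ho' he
      rcases lt_trichotomy o o' with hlt | hlt | hlt
      · exact absurd he (hmono _ ho _ ho' hlt).ne
      · exact hlt
      · exact absurd he (hmono _ ho' _ ho hlt).ne'
    obtain ⟨x, hxp, hx⟩ := hc p₀ (by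
      intro ψ hψ
      obtain ⟨ψ, -, rfl⟩ := Finset.mem_image.1 hψ
      exact ψ.2) (H.sup id + 1) {i | ∃ o ∈ P, h o = i ∧ η o}
    refine ⟨Sum.elim x fun z => c (h z.1) z.2, fun S hS => ?_⟩
    obtain ⟨ψ | q | o, hT, rfl⟩ := Finset.mem_image.1 hS
    · exact hxp ψ.1 (Finset.mem_image_of_mem _ (Finset.mem_toLeft.2 hT))
    · have hq : q ∈ X₀ := Finset.mem_toLeft.2 (Finset.mem_toRight.2 hT)
      have key (f : Fin q.1 ↪o O) (hf : ∀ j, f j ∈ P) :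
          ∃ S ⊆ H, ∃ hS : S.card = q.1, ∀ j, S.orderEmbOfFin hS j = h (f j) := by
        have hfm : StrictMono fun j => h (f j) := fun j j' hj =>
          hmono _ (hf j) _ (hf j') (f.strictMono hj)
        have hcard : (Finset.univ.image fun j => h (f j)).card = q.1 := by
          rw [Finset.card_image_of_injective _ hfm.injective, Finset.card_fin]
        refine ⟨_, ?_, hcard, fun j => ?_⟩
        · intro i hi
          obtain ⟨j, -, rfl⟩ := Finset.mem_image.1 hi
          exact hmem _ (hf j)
        · exact (congrFun (Finset.orderEmbOfFin_unique hcard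
            (fun j => Finset.mem_image_of_mem _ (Finset.mem_univ j)) hfm) j).symm
      obtain ⟨S, hSH, hSc, hS⟩ := key q.2.2.1 fun j => Finset.mem_union_right _
        (Finset.mem_biUnion.2 ⟨q, hq, Finset.mem_union_left _
          (Finset.mem_image_of_mem _ (Finset.mem_univ j))⟩)
      obtain ⟨S', hSH', hSc', hS'⟩ := key q.2.2.2 fun j => Finset.mem_union_right _
        (Finset.mem_biUnion.2 ⟨q, hq, Finset.mem_union_right _
          (Finset.mem_image_of_mem _ (Finset.mem_univ j))⟩)
      have := hH ⟨q, hq⟩ S hSH S' hSH' hSc hSc'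
      simp only [hSc, hSc', hS, hS', forall_true_left] at this
      exact this
    · have ho : o ∈ P := Finset.mem_union_left _ (Finset.mem_toRight.2 (Finset.mem_toRight.2 hT))
      refine (hx (h o) (Nat.lt_succ_of_le (Finset.le_sup (f := id) (hmem o ho)))).trans ?_
      constructor
      · rintro ⟨o', ho', he, hη⟩
        rwa [← hinj _ ho' _ ho he]
      · exact fun hη => ⟨o, ho, rfl, hη⟩)
  refine ⟨fun i => v (Sum.inl i), fun o t => v (Sum.inr (o, t)), fun ψ hψ => ?_,
    fun k χ f g => ?_, fun o => ?_⟩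
  · exact hv _ ⟨Sum.inl ⟨ψ, hψ⟩, rfl⟩
  · exact hv _ ⟨Sum.inr (Sum.inl ⟨k, χ, f, g⟩), rfl⟩
  · exact hv _ ⟨Sum.inr (Sum.inr o), rfl⟩

/-- The rows of an indiscernible array, ordered lexicographically, are mutually indiscernible. -/
theorem mutuallyIndiscernible_rows {A : Set M} {K : Type w} [LinearOrder K] {d : K ×ₗ ℕ → ℕ → M}
    (hd : Indiscernible L A d) :
    MutuallyIndiscernible L A (ι := fun _ => ULift.{w} ℕ) (γ := fun _ => ULift.{w} ℕ)
      (fun (k : K) i t => d (toLex (k, i.down)) t.down) := by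
  classical
  intro k
  rw [indiscernible_iff_definable]
  intro m S hS f g
  obtain ⟨φ, rfl⟩ := definable_iff_exists_formula_sum.1 hS
  -- The parameters are entries of the array outside of row `k`, or lie in `A`.
  have hpar : ∀ x : ↥(A ∪ ⋃ j ∈ {j | j ≠ k}, entries
      fun (i t : ULift.{w} ℕ) => d (toLex (j, i.down)) t.down),
      ∃ e : A ⊕ {o : K ×ₗ ℕ // (ofLex o).1 ≠ k} × ℕ,
        Sum.elim (↑) (fun z => d z.1.1 z.2) e = x.1 := by
    rintro ⟨x, hx | hx⟩
    · exact ⟨Sum.inl ⟨x, hx⟩, rfl⟩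
    · simp only [mem_iUnion] at hx
      obtain ⟨j, hj, i, t, rfl⟩ := hx
      exact ⟨Sum.inr (⟨toLex (j, i.down), hj⟩, t.down), rfl⟩
  choose e he using hpar
  let r (f : Fin m ↪o ULift.{w} ℕ) : {o : K ×ₗ ℕ // (ofLex o).1 ≠ k} ⊕ Fin m → K ×ₗ ℕ :=
    Sum.elim Subtype.val fun j => toLex (k, (f j).down)
  have hfj (f : Fin m ↪o ULift.{w} ℕ) (j j' : Fin m) : (f j).down < (f j').down ↔ j < j' :=
    f.lt_iff_lt
  have hr : ∀ z z', r f z < r f z' ↔ r g z < r g z' := by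
    rintro (⟨o, ho⟩ | j) (⟨o', ho'⟩ | j')
    · rfl
    · simp [r, Prod.Lex.lt_iff, ho]
    · simp [r, Prod.Lex.lt_iff, Ne.symm ho']
    · simp [r, Prod.Lex.lt_iff, hfj]
  have key := hd.mem_iff hr (definable_of_formula A φ)
    (Sum.elim (fun x => Sum.map id (Prod.map Sum.inl id) (e x))
      fun z => Sum.inr (Sum.inr z.1, z.2.down))
  have hval (f : Fin m ↪o ULift.{w} ℕ) : (fun i => Sum.elim (↑)
      (fun z : ({o : K ×ₗ ℕ // (ofLex o).1 ≠ k} ⊕ Fin m) × ℕ => d (r f z.1) z.2)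
      ((Sum.elim (fun x => Sum.map id (Prod.map Sum.inl id) (e x))
        fun z => Sum.inr (Sum.inr z.1, z.2.down) : _ ⊕ Fin m × ULift.{w} ℕ → _) i)) =
      Sum.elim (↑) fun z => d (toLex (k, (f z.1).down)) z.2.down := by
    funext i
    rcases i with x | z
    · rw [Sum.elim_inl, Sum.elim_inl, ← he x]
      rcases e x with _ | _ <;> rfl
    · rfl
  rw [hval, hval] at key
  exact key

/-- A dependent type does not admit the independence property. -/
theorem IsDependent.not_hasIP {κ : Cardinal.{w}} (hM : IsSaturated L M κ) (hκ : ℵ₀ < κ)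
    {A : Set M} (hA : #A < κ) {n : ℕ} {p : Set (L[[A]].Formula (Fin n))} (hp : IsDependent κ p)
    (φ : L.Formula (Fin n ⊕ ℕ)) : ¬ HasIP p φ := by
  intro hφ
  obtain ⟨μ, hμ, hrank⟩ := hp
  let K := μ.out
  let _ : LinearOrder K := IsWellOrder.linearOrder WellOrderingRel
  have hO : #(K ×ₗ ℕ) < κ := by
    change #(K × ℕ) < κ
    rw [mk_prod, mk_nat, lift_aleph0, lift_uzero, mk_out]
    exact mul_lt_of_lt hκ.le hμ hκ
  obtain ⟨b, d, hb, hd, hη⟩ := hφ.exists_indiscernible hM hκ hA hO fun o => (ofLex o).2 = 0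
  obtain ⟨k, hk⟩ := hrank b hb K (fun _ => ULift.{w} ℕ) (fun _ => ULift.{w} ℕ) _ (mk_out μ)
    (mutuallyIndiscernible_rows hd)
  -- `φ(b; y)` separates the first two members of the row `k`.
  have hS := definable_subst (definable_of_formula (A ∪ range b) φ)
    (Sum.elim (fun i => Sum.inl ⟨b i, Or.inr (mem_range_self i)⟩)
      (fun t => Sum.inr (0, ULift.up t)) : _ → _ ⊕ Fin 1 × ULift.{w} ℕ)
  let f (i : ℕ) : Fin 1 ↪o ULift.{w} ℕ :=
    OrderEmbedding.ofStrictMono (fun _ => ULift.up i) (Subsingleton.strictMono _)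
  have key := indiscernible_iff_definable.1 hk 1 _ hS (f 0) (f 1)
  have hval (i : ℕ) : (fun z => Sum.elim (↑)
      (fun z : Fin 1 × ULift.{w} ℕ => d (toLex (k, (f i z.1).down)) z.2.down)
      ((Sum.elim (fun i => Sum.inl ⟨b i, Or.inr (mem_range_self i)⟩)
      (fun t => Sum.inr (0, ULift.up t)) : _ → ↥(A ∪ range b) ⊕ Fin 1 × ULift.{w} ℕ) z)) =
      Sum.elim b (d (toLex (k, i))) := by
    funext z
    rcases z with z | z <;> rfl
  simp only [mem_ofPred_eq, hval, hη] at key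
  simp at key

end IndependenceProperty

/-! ### Indiscernible end segments -/

section EndSegments

variable {L : FirstOrder.Language.{u, v}} {M : Type w} [L.Structure M]
variable {ι : Type x} [LinearOrder ι] {γ : Type y} {a : ι → γ → M} {C : Set M}

/-- A failure of indiscernibility over `C` and a tuple `b` is witnessed by a formula `φ(x; y)`
without parameters, with `b` for `x` and elements of `C` and coordinates of the sequence for `y`.
The variables of `φ` depend neither on `C` nor on the length `γ`, so that there are only `|T|`
possibilities for `φ`. -/
theorem exists_formula_of_not_indiscernible {n : ℕ} {b : Fin n → M}
    (h : ¬ Indiscernible L (C ∪ range b) a) :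
    ∃ (φ : L.Formula (Fin n ⊕ ℕ)) (k : ℕ) (e : ℕ → C ⊕ Fin k × γ) (f g : Fin k ↪o ι),
      φ.Realize (Sum.elim b fun t => Sum.elim (↑) (fun z => a (f z.1) z.2) (e t)) ∧
      ¬ φ.Realize (Sum.elim b fun t => Sum.elim (↑) (fun z => a (g z.1) z.2) (e t)) := by
  classical
  rw [indiscernible_iff_definable] at h
  push Not at h
  obtain ⟨k, S, hS, f, g, hfg⟩ := h
  obtain ⟨f, g, hf, hg⟩ : ∃ f g : Fin k ↪o ι,
      (fun z : Fin k × γ => a (f z.1) z.2) ∈ S ∧ (fun z => a (g z.1) z.2) ∉ S := by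
    rcases hfg with h | h
    · exact ⟨f, g, h⟩
    · exact ⟨g, f, h.symm⟩
  obtain ⟨φ, rfl⟩ := definable_iff_exists_formula_sum.1 hS
  have hσ : ∀ d : ↥(C ∪ range b), ∃ i : Fin n ⊕ C, Sum.elim b (↑) i = d.1 := by
    rintro ⟨d, hd | ⟨i, rfl⟩⟩
    · exact ⟨Sum.inr ⟨d, hd⟩, rfl⟩
    · exact ⟨Sum.inl i, rfl⟩
  choose σ hσ using hσ
  obtain ⟨z₀⟩ : Nonempty (Fin k × γ) := by
    by_contra hne
    rw [not_nonempty_iff] at hne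
    exact hg (by convert hf using 1)
  let val (f : Fin k ↪o ι) : C ⊕ Fin k × γ → M := Sum.elim (↑) fun z => a (f z.1) z.2
  let φ' : L.Formula (Fin n ⊕ (C ⊕ Fin k × γ)) :=
    φ.relabel (Sum.elim (fun d => Sum.map id Sum.inl (σ d)) fun z => Sum.inr (Sum.inr z))
  have hφ' (f : Fin k ↪o ι) : φ'.Realize (Sum.elim b (val f)) ↔
      φ.Realize (Sum.elim (↑) fun z => a (f z.1) z.2) := by
    rw [Language.Formula.realize_relabel]
    apply iff_of_eq
    congr 1
    funext d
    rcases d with d | z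
    · change Sum.elim b (val f) (Sum.map id Sum.inl (σ d)) = d.1
      rw [← hσ d]
      rcases σ d with _ | _ <;> rfl
    · rfl
  -- Only finitely many variables occur, so they can be renamed by natural numbers.
  obtain ⟨F, hF⟩ := definable_exists_support (definable_of_formula (∅ : Set M) φ')
  obtain ⟨e, he⟩ := (insert (Sum.inr z₀) F.toRight).countable_toSet.exists_eq_range
    ⟨Sum.inr z₀, by simp⟩
  have hidx : ∀ c, ∃ t, c ∈ F.toRight → e t = c := by
    intro c
    by_cases hc : c ∈ F.toRight
    · obtain ⟨t, ht⟩ : c ∈ range e := he ▸ Finset.mem_coe.2 (Finset.mem_insert_of_mem hc)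
      exact ⟨t, fun _ => ht⟩
    · exact ⟨0, fun h => absurd h hc⟩
  choose idx hidx using hidx
  have hreal (f : Fin k ↪o ι) :
      (φ'.relabel (Sum.map id idx)).Realize (Sum.elim b fun t => val f (e t)) ↔
      φ.Realize (Sum.elim (↑) fun z => a (f z.1) z.2) := by
    rw [← hφ', Language.Formula.realize_relabel]
    refine hF _ _ fun i hi => ?_
    rcases i with i | c
    · rfl
    · exact congrArg (val f) (hidx c (Finset.mem_toRight.2 hi))
  exact ⟨φ'.relabel (Sum.map id idx), k, e, f, g, (hreal f).2 hf, fun h => hg ((hreal g).1 h)⟩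

/-- If one formula `φ(b; y)` separates, arbitrarily far in a sequence indiscernible over `C`, pairs
of increasing tuples, then it has the independence property on every type that `b` realizes: on
disjoint blocks `f i`, `g i`, any pattern is realized by `b` after replacing some of the `f i` by
`g i`, and by indiscernibility the pattern is realized without the replacement. -/
theorem hasIP_of_cofinal [Nonempty ι] (ha : Indiscernible L C a) {A : Set M} (hAC : A ⊆ C) {n : ℕ}
    {p : Set (L[[A]].Formula (Fin n))} {b : Fin n → M} (hb : Realizes p b)
    (φ : L.Formula (Fin n ⊕ ℕ))
    (h : ∀ α : ι, ∃ (k : ℕ) (e : ℕ → C ⊕ Fin k × γ) (f g : Fin k ↪o ι),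
      ((∀ j, α < f j) ∧ ∀ j, α < g j) ∧
      φ.Realize (Sum.elim b fun t => Sum.elim (↑) (fun z => a (f z.1) z.2) (e t)) ∧
      ¬ φ.Realize (Sum.elim b fun t => Sum.elim (↑) (fun z => a (g z.1) z.2) (e t))) :
    HasIP p φ := by
  classical
  choose k e f g hα hf hg using h
  have hnext : ∀ α, ∃ β, α ≤ β ∧ (∀ j, f α j ≤ β) ∧ ∀ j, g α j ≤ β := by
    intro α
    obtain ⟨β, hβ⟩ := (insert α (Finset.univ.image (f α) ∪ Finset.univ.image (g α))).exists_le
    refine ⟨β, hβ _ (by simp), fun j => hβ _ ?_, fun j => hβ _ ?_⟩ <;> simp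
  choose next hnext hnf hng using hnext
  let s (i : ℕ) : ι := next^[i] (Classical.arbitrary ι)
  have hs (i : ℕ) : s (i + 1) = next (s i) := Function.iterate_succ_apply' ..
  have hmono : Monotone s := monotone_nat_of_le_succ fun i => hs i ▸ hnext (s i)
  -- Block `i` of `r u` is the tuple `f` or `g`, according to whether `i ∈ u`; the order type of
  -- `r u` does not depend on `u`.
  let r (u : Set ℕ) (z : Σ i, Fin (k (s i))) : ι := if z.1 ∈ u then f (s z.1) z.2 else g (s z.1) z.2
  have hlow (u : Set ℕ) (z) : s z.1 < r u z := by
    dsimp only [r]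
    split_ifs
    exacts [(hα _).1 _, (hα _).2 _]
  have hhigh (u : Set ℕ) (z) : r u z ≤ s (z.1 + 1) := by
    dsimp only [r]
    rw [hs]
    split_ifs
    exacts [hnf _ _, hng _ _]
  have hlt (u : Set ℕ) {z z'} (hz : z.1 < z'.1) : r u z < r u z' :=
    ((hhigh u z).trans (hmono hz)).trans_lt (hlow u z')
  have hr (u u' : Set ℕ) : ∀ z z', r u z < r u z' ↔ r u' z < r u' z' := by
    rintro ⟨i, j⟩ ⟨i', j'⟩
    rcases lt_trichotomy i i' with hi | rfl | hi
    · exact iff_of_true (hlt u hi) (hlt u' hi)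
    · dsimp only [r]
      split_ifs <;> simp
    · exact iff_of_false (hlt u (z := ⟨i', j'⟩) (z' := ⟨i, j⟩) hi).not_gt
        (hlt u' (z := ⟨i', j'⟩) (z' := ⟨i, j⟩) hi).not_gt
  let c (u : Set ℕ) (i t : ℕ) : M := Sum.elim (↑) (fun z => a (r u ⟨i, z.1⟩) z.2) (e (s i) t)
  have hc (u : Set ℕ) (i : ℕ) : φ.Realize (Sum.elim b (c u i)) ↔ i ∈ u := by
    by_cases hi : i ∈ u
    · simpa [c, r, hi] using hf (s i)
    · simpa [c, r, hi] using hg (s i)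
  refine ⟨c univ, fun p₀ hp₀ N u => ?_⟩
  have hdef : C.Definable L {y : ℕ × ℕ → M | ∃ x : Fin n → M, Sum.elim y x ∈
      {v : ℕ × ℕ ⊕ Fin n → M | ∀ ψ ∈ p₀, ψ.Realize fun i => v (Sum.inr i)} ∩
      {v | ∀ i ∈ Finset.range N, (φ.Realize
        (Sum.elim (fun j => v (Sum.inr j)) fun t => v (Sum.inl (i, t))) ↔ i ∈ u)}} := by
    refine Definable.exists_of_finite (Definable.inter ?_ ?_)
    · have hψ (ψ : L[[A]].Formula (Fin n)) :
          C.Definable L {v : ℕ × ℕ ⊕ Fin n → M | ψ.Realize fun i => v (Sum.inr i)} := by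
        have h : A.Definable L {v : Fin n → M | ψ.Realize v} := ⟨ψ, rfl⟩
        exact (h.mono hAC).preimage_comp Sum.inr
      convert definable_biInter_finset hψ p₀ using 1
      ext v
      simp
    · have hi (i : ℕ) : C.Definable L {v : ℕ × ℕ ⊕ Fin n → M | φ.Realize
          (Sum.elim (fun j => v (Sum.inr j)) fun t => v (Sum.inl (i, t))) ↔ i ∈ u} := by
        refine definable_iff_const ?_ _
        convert (definable_of_formula C φ).preimage_comp
          (Sum.elim Sum.inr (fun t => Sum.inl (i, t)) : Fin n ⊕ ℕ → ℕ × ℕ ⊕ Fin n) using 1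
        ext v
        simp only [mem_ofPred_eq, mem_preimage]
        apply iff_of_eq
        congr 1
        funext j
        rcases j with j | j <;> rfl
      convert definable_biInter_finset hi (Finset.range N) using 1
      ext v
      simp
  have key := ha.mem_iff (hr univ u) hdef
    (fun y => Sum.map id (fun z => (⟨y.1, z.1⟩, z.2)) (e (s y.1) y.2))
  have hval (u : Set ℕ) : (fun y : ℕ × ℕ => Sum.elim (↑)
      (fun z : (Σ i, Fin (k (s i))) × γ => a (r u z.1) z.2)
      (Sum.map id (fun z => (⟨y.1, z.1⟩, z.2)) (e (s y.1) y.2) : C ⊕ _)) =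
      fun y => c u y.1 y.2 := by
    funext y
    dsimp only [c]
    rcases e (s y.1) y.2 with _ | _ <;> rfl
  rw [hval, hval] at key
  obtain ⟨x, hx, hx'⟩ := key.2 ⟨b, fun ψ hψ => hb ψ (hp₀ hψ), fun i _ => hc u i⟩
  exact ⟨x, hx, fun i hi => hx' i (Finset.mem_range.2 hi)⟩

/-- The case of one realization: on an index order of cofinality greater than the number of
formulas, some formula accounts for cofinally many of the failures. -/
theorem exists_tail_indiscernible [Nonempty ι] (hι : ∀ F : L.Formula ℕ → ι, ∃ β, ∀ φ, F φ ≤ β)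
    (ha : Indiscernible L C a) {A : Set M} (hAC : A ⊆ C) {n : ℕ}
    {p : Set (L[[A]].Formula (Fin n))} (hp : ∀ φ, ¬ HasIP p φ) {b : Fin n → M}
    (hb : Realizes p b) :
    ∃ α : ι, Indiscernible L (C ∪ range b) fun i : Ioi α => a i := by
  by_contra! hall
  choose Φ k e f g hf hg using fun α => exists_formula_of_not_indiscernible (hall α)
  obtain ⟨φ, hφ⟩ : ∃ φ, ∀ α, ∃ β, α ≤ β ∧ Φ β = φ := by
    by_contra! hno
    choose F hF using hno
    have E : Fin n ⊕ ℕ ≃ ℕ := Classical.choice (Cardinal.eq.1 (by simp))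
    obtain ⟨β, hβ⟩ := hι fun ψ => F (Language.BoundedFormula.relabelEquiv E.symm ψ)
    refine hF (Φ β) β ?_ rfl
    simpa using hβ ((Language.BoundedFormula.relabelEquiv E.symm).symm (Φ β))
  refine hp φ (hasIP_of_cofinal ha hAC hb φ fun α => ?_)
  obtain ⟨β, hαβ, rfl⟩ := hφ α
  exact ⟨k β, e β, (f β).trans (OrderEmbedding.subtype _), (g β).trans (OrderEmbedding.subtype _),
    ⟨fun j => hαβ.trans_lt (f β j).2, fun j => hαβ.trans_lt (g β j).2⟩, hf β, hg β⟩

/-- The case of finitely many realizations, which are added one at a time. -/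
theorem exists_tail_indiscernible_finset [NoMaxOrder ι] [Nonempty ι]
    (hι : ∀ F : L.Formula ℕ → ι, ∃ β, ∀ φ, F φ ≤ β)
    {A : Set M} (ha : Indiscernible L A a) {n : ℕ}
    {p : Set (L[[A]].Formula (Fin n))} (hp : ∀ φ, ¬ HasIP p φ) (B : Finset (Fin n → M))
    (hB : ∀ b ∈ B, Realizes p b) :
    ∃ α : ι, Indiscernible L (A ∪ ⋃ b ∈ B, range b) fun i : Ioi α => a i := by
  classical
  induction B using Finset.induction_on with
  | empty =>
    refine ⟨Classical.arbitrary ι, ?_⟩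
    simpa using ha.comp (ι' := Ioi (Classical.arbitrary ι)) (OrderEmbedding.subtype _)
  | insert b B _ ih =>
    obtain ⟨α, hα⟩ := ih fun b hb => hB b (Finset.mem_insert_of_mem hb)
    obtain ⟨⟨β, hαβ⟩, hβ⟩ := exists_tail_indiscernible (ι := Ioi α) (fun F => by
      obtain ⟨β, hβ⟩ := hι fun φ => (F φ : ι)
      obtain ⟨δ, hδ⟩ := exists_gt (max α β)
      exact ⟨⟨δ, (le_max_left _ _).trans_lt hδ⟩, fun φ =>
        ((hβ φ).trans (le_max_right _ _)).trans hδ.le⟩) hα subset_union_left hp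
      (hB b (Finset.mem_insert_self _ _))
    refine ⟨β, ?_⟩
    have := hβ.comp (ι' := Ioi β) (OrderEmbedding.ofStrictMono
      (fun i => ⟨⟨i.1, mem_Ioi.2 (lt_trans hαβ i.2)⟩, i.2⟩) fun i j hij => hij)
    refine Indiscernible.mono this ?_
    rw [Finset.set_biUnion_insert, union_comm (range b), union_assoc]

/-- The case of an arbitrary set of realizations, on an index order in which every family of
members indexed by the formulas, or by the finite sets of realizations, is bounded. -/
theorem exists_tail_indiscernible_set [NoMaxOrder ι] [Nonempty ι]
    (hι : ∀ F : L.Formula ℕ → ι, ∃ β, ∀ φ, F φ ≤ β)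
    {A : Set M} (ha : Indiscernible L A a) {n : ℕ}
    {p : Set (L[[A]].Formula (Fin n))} (hp : ∀ φ, ¬ HasIP p φ) (B : Set (Fin n → M))
    (hB : ∀ b ∈ B, Realizes p b) (hιB : ∀ F : Finset B → ι, ∃ β, ∀ s, F s ≤ β) :
    ∃ α : ι, Indiscernible L (A ∪ ⋃ b ∈ B, range b) fun i : Ioi α => a i := by
  classical
  have htail : ∀ s : Finset B, ∃ α : ι, Indiscernible L
      (A ∪ ⋃ b ∈ s.image Subtype.val, range b) fun i : Ioi α => a i := fun s =>
    exists_tail_indiscernible_finset hι ha hp _ fun b hb => by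
      obtain ⟨b, -, rfl⟩ := Finset.mem_image.1 hb
      exact hB b b.2
  choose F hF using htail
  obtain ⟨β, hβ⟩ := hιB F
  refine ⟨β, indiscernible_of_finite fun D hD => ?_⟩
  have hpick : ∀ d : D, ∃ s : Finset B, d.1 ∈ A ∪ ⋃ b ∈ s.image Subtype.val, range b := by
    intro d
    rcases hD d.2 with hd | hd
    · exact ⟨∅, Or.inl hd⟩
    · simp only [mem_iUnion] at hd
      obtain ⟨b, hb, hd⟩ := hd
      exact ⟨{⟨b, hb⟩}, Or.inr (by simpa using hd)⟩
  choose s hs using hpick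
  have := (hF (Finset.univ.biUnion s)).comp (ι' := Ioi β) (OrderEmbedding.ofStrictMono
    (fun i => ⟨i.1, (hβ _).trans_lt i.2⟩) fun i j hij => hij)
  refine Indiscernible.mono this fun d hd => ?_
  refine union_subset_union_right A (biUnion_subset_biUnion_left ?_) (hs ⟨d, hd⟩)
  exact Finset.coe_subset.2 (Finset.image_subset_image
    (Finset.subset_biUnion_of_mem s (Finset.mem_univ _)))

end EndSegments

/-! ### Bounds from regularity -/

section Cofinality

theorem aleph0_le_theoryCard {L : FirstOrder.Language.{u, v}} (T : L.Theory) :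
    ℵ₀ ≤ theoryCard T := by
  have : Infinite (L.Formula ℕ) := Infinite.of_injective
    (fun i : ℕ => (Language.Term.var i).equal (Language.Term.var 0)) fun i j h => by
      simpa [Language.Term.equal, Language.Term.bdEqual, Language.Term.relabel] using h
  exact aleph0_le_mk _

/-- Below the initial ordinal of a regular cardinal, families of smaller size are bounded. -/
theorem exists_le_of_lift_mk_lt {X : Type y} {θ : Cardinal.{max x y}} (hθ : θ.IsRegular)
    (hX : Cardinal.lift.{max x y} #X < θ) (F : X → Iio θ.ord) : ∃ β, ∀ i, F i ≤ β := by
  have hsup : ⨆ i, (F i).1 < θ.ord := by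
    refine Ordinal.lift_iSup_lt_of_lt_cof ?_ fun i => (F i).2
    rwa [Ordinal.lift_id'.{y, max x y}, hθ.cof_ord]
  exact ⟨⟨_, hsup⟩, fun i => Ordinal.le_iSup (fun i => (F i).1) i⟩

end Cofinality

end DpRank

theorem mainTheorem9 {L : FirstOrder.Language.{u, v}} (T : L.Theory) (hT : T.IsComplete)
    {M : Type w} [L.Structure M] (κ : Cardinal.{w}) (hM : DpRank.IsMonster T M κ)
    (A : Set M) (hA : #A < κ)
    {n : ℕ} (p : Set (L[[A]].Formula (Fin n))) (hp : DpRank.IsDependent κ p)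
    (B : Set (Fin n → M)) (hB : ∀ b ∈ B, DpRank.Realizes p b)
    {γ : Type y}
    (a : Set.Iio (Cardinal.lift.{w} (Order.succ (DpRank.theoryCard T)) +
      Cardinal.lift.{max u v} (Order.succ #B)).ord → γ → M)
    (ha : DpRank.Indiscernible L A a) :
    ∃ α : Set.Iio (Cardinal.lift.{w} (Order.succ (DpRank.theoryCard T)) +
      Cardinal.lift.{max u v} (Order.succ #B)).ord,
      DpRank.Indiscernible L (A ∪ ⋃ b ∈ B, Set.range b)
        (fun i : Set.Ioi α => a i) := by
  have hT₀ := DpRank.aleph0_le_theoryCard T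
  have hκ : ℵ₀ < κ := by
    have h := (lift_lt.{max u v, w}.2 (Order.lt_succ_of_le hT₀)).trans hM.large
    rwa [lift_aleph0, ← lift_aleph0.{max u v, w}, lift_lt] at h
  set θ := Cardinal.lift.{w} (Order.succ (DpRank.theoryCard T)) +
    Cardinal.lift.{max u v} (Order.succ #B) with hθ
  have hlarge : ℵ₀ ≤ Cardinal.lift.{w} (Order.succ (DpRank.theoryCard T)) :=
    aleph0_le_lift.2 (hT₀.trans (Order.le_succ _))
  -- The length is the successor of an infinite cardinal, hence regular.
  have hreg : θ.IsRegular := by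
    have : θ = Order.succ
        (max (Cardinal.lift.{w} (DpRank.theoryCard T)) (Cardinal.lift.{max u v} #B)) := by
      rw [hθ, add_eq_max hlarge, lift_succ, lift_succ, Order.succ_max]
    rw [this]
    exact isRegular_succ ((aleph0_le_lift.2 hT₀).trans (le_max_left _ _))
  have hlim : Order.IsSuccLimit θ.ord := isSuccLimit_ord hreg.aleph0_le
  have : Nonempty (Iio θ.ord) := ⟨⟨0, hlim.bot_lt⟩⟩
  have : NoMaxOrder (Iio θ.ord) := ⟨fun i => ⟨⟨_, hlim.succ_lt i.2⟩, Order.lt_succ i.1⟩⟩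
  refine DpRank.exists_tail_indiscernible_set (fun F => ?_) ha
    (hp.not_hasIP hM.saturated hκ hA) B hB fun F => ?_
  · refine DpRank.exists_le_of_lift_mk_lt.{w, max u v} hreg ?_ F
    rw [lift_umax.{max u v, w}]
    exact (lift_lt.2 (Order.lt_succ (DpRank.theoryCard T))).trans_le le_self_add
  · refine DpRank.exists_le_of_lift_mk_lt.{max u v, w} hreg ?_ F
    rw [lift_umax.{w, max u v}]
    rcases finite_or_infinite B with hfin | hinf
    · exact (lift_lt_aleph0.2 (lt_aleph0_of_finite _)).trans_le (hlarge.trans le_self_add)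
    · rw [mk_finset_of_infinite]
      exact (lift_lt.2 (Order.lt_succ #B)).trans_le le_add_self
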